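/- Let $\Phi_e$ be the $e$-th partial computable function. A CSC (countable second-countable) space is given by a sequence $\mathcal U=(U_i)_{i\in\omega}$ of subsets of $\omega$ with $\bigcup_i U_i=\omega$ together with a function $k:\omega^3\to\omega$ such that $x\in U_{k(i,j,x)}\subseteq U_i\cap U_j$ whenever $x\in U_i\cap U_j$; the $U_i$ form a base of a topology on $\omega$. An index of such a space is a number $e=\langle m,n\rangle$ such that $\Phi_m$ is total and is the characteristic function of $\{(i,x): x\in U_i\}$, and $\Phi_n$ is total and computes $k$. Let $T_2\text{-}CSC$ and $T_{2\frac12}\text{-}CSC$ be the sets of indices of CSC spaces that are Hausdorff, respectively Urysohn (any two distinct points have disjoint closed neighbourhoods). For $A\subseteq C\subseteq\omega$ and a class $\Gamma$ of subsets of $\omega$, $A$ is $\Gamma$-complete within $C$ if (i) $A=B\cap C$ for some $B\in\Gamma$, and (ii) for every $B\in\Gamma$ there is a computable $f:\omega\to\omega$ such that for all $e$, $f(e)\in C$ and ($e\in B\iff f(e)\in A$). Theorem. 1. $T_{2\frac12}\text{-}CSC$ is a $\Pi^0_5$ set. 2. $T_{2\frac12}\text{-}CSC$ is $\Pi^0_5$-complete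 within $T_2\text{-}CSC$. 3. Moreover, for every $\Sigma^0_4$ relation $A\subseteq\omega\times\omega$ there are a computable function $f$ and points $p_m\neq q_m$ in $\omega$ ($m\in\omega$) such that for every $n$ the number $f(n)$ is an index of a Hausdorff CSC space $X_n$ in which, for every $m$, the points $p_m$ and $q_m$ are separated by closed neighbourhoods if and only if $(n,m)\in A$; and $X_n$ is Urysohn if and only if $(n,m)\in A$ for all $m$. -/

import Mathlib

open Topology

/-! ### The arithmetical hierarchy on sets of natural numbers -/

/-- `IsSigma n A`: the set `A` is `Σ⁰ₙ`.  At level `0` these are the computable sets; `A` is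
`Σ⁰ₙ₊₁` iff `x ∈ A ↔ ∃ y, ⟨x, y⟩ ∈ B` for some `Π⁰ₙ` set `B` (one whose complement is `Σ⁰ₙ`). -/
def IsSigma : ℕ → Set ℕ → Prop
  | 0, A => ComputablePred (fun x => x ∈ A)
  | n + 1, A => ∃ B : Set ℕ, IsSigma n Bᶜ ∧ ∀ x, x ∈ A ↔ ∃ y, Nat.pair x y ∈ B

/-- The class of `Π⁰ₙ` sets: the complements of the `Σ⁰ₙ` sets. -/
def PiClass (n : ℕ) : Set (Set ℕ) := {A | IsSigma n Aᶜ}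

/-! ### Complexity within a set -/

/-- `A` is `Γ` within `C`. -/
def ClassWithin (Γ : Set (Set ℕ)) (A C : Set ℕ) : Prop :=
  ∃ B ∈ Γ, A = B ∩ C

/-- `A` is `Γ`-hard within `C`. -/
def HardWithin (Γ : Set (Set ℕ)) (A C : Set ℕ) : Prop :=
  ∀ B ∈ Γ, ∃ f : ℕ → ℕ, Computable f ∧ ∀ e, f e ∈ C ∧ (e ∈ B ↔ f e ∈ A)

/-- `A` is `Γ`-complete within `C`. -/
def CompleteWithin (Γ : Set (Set ℕ)) (A C : Set ℕ) : Prop :=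
  ClassWithin Γ A C ∧ HardWithin Γ A C

/-! ### Countable second-countable spaces -/

/-- A CSC space with underlying set `ω`: a sequence `U` of subsets of `ω` covering `ω`, with a
function `k` such that `x ∈ U (k i j x) ⊆ U i ∩ U j` whenever `x ∈ U i ∩ U j`. -/
structure CSCSpace where
  U : ℕ → Set ℕ
  k : ℕ → ℕ → ℕ → ℕ
  cover : ∀ x, ∃ i, x ∈ U i
  mem_k : ∀ i j x, x ∈ U i ∩ U j → x ∈ U (k i j x)
  k_subset : ∀ i j x, x ∈ U i ∩ U j → U (k i j x) ⊆ U i ∩ U j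

namespace CSCSpace

/-- The points of a CSC space: the natural numbers, with the topology generated by the base
instead of the usual one. -/
def Point (_X : CSCSpace) : Type := ℕ

instance (X : CSCSpace) : TopologicalSpace X.Point :=
  TopologicalSpace.generateFrom (Set.range X.U : Set (Set ℕ))

/-- The sets `U i` really are a basis of the topology, not just a subbasis. -/
theorem isTopologicalBasis (X : CSCSpace) :
    TopologicalSpace.IsTopologicalBasis (α := X.Point) (Set.range X.U : Set (Set ℕ)) where
  exists_subset_inter := by
    rintro _ ⟨i, rfl⟩ _ ⟨j, rfl⟩ x hx
    exact ⟨X.U (X.k i j x), ⟨_, rfl⟩, X.mem_k i j x hx, X.k_subset i j x hx⟩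
  sUnion_eq := by
    refine Set.eq_univ_of_forall fun x => ?_
    obtain ⟨i, hi⟩ := X.cover x
    exact ⟨X.U i, ⟨i, rfl⟩, hi⟩
  eq_generateFrom := rfl

/-- The points `x` and `y` of `X` are separated by closed neighbourhoods. -/
def SeparatedByClosedNhds (X : CSCSpace) (x y : X.Point) : Prop :=
  ∃ C ∈ 𝓝 x, ∃ D ∈ 𝓝 y, IsClosed C ∧ IsClosed D ∧ Disjoint C D

end CSCSpace

/-! ### Indices -/

/-- The `e`-th partial computable function `Φ_e`. -/
def Phi (e : ℕ) : ℕ →. ℕ := (Denumerable.ofNat Nat.Partrec.Code e).eval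

/-- `e = ⟨m, n⟩` is an index for `X`: `Φ_m` is the (total) characteristic function of the
sequence `U`, and `Φ_n` is total and computes `k`. -/
structure IsIndex (e : ℕ) (X : CSCSpace) : Prop where
  of_mem : ∀ i x, x ∈ X.U i → 1 ∈ Phi e.unpair.1 (Nat.pair i x)
  of_notMem : ∀ i x, x ∉ X.U i → 0 ∈ Phi e.unpair.1 (Nat.pair i x)
  computes_k : ∀ i j x, X.k i j x ∈ Phi e.unpair.2 (Nat.pair i (Nat.pair j x))

/-- The index set of the Hausdorff CSC spaces. -/
def T2CSC : Set ℕ := {e | ∃ X : CSCSpace, IsIndex e X ∧ T2Space X.Point}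

/-- The index set of the Urysohn CSC spaces. -/
def T25CSC : Set ℕ := {e | ∃ X : CSCSpace, IsIndex e X ∧ T25Space X.Point}

open Encodable
open Nat.Partrec (Code)

/-! ### A calculus for the arithmetical hierarchy -/

/-! Upper bound: `separatedByClosedNhds_iff` reduces separation of x and y to basic sets: some U i,
U j around them such that every z has a basic neighbourhood missing one of the two. With membership
Σ⁰₁, this is Σ⁰₄; quantifying over x and y gives Π⁰₅, and being an index is only Π⁰₄.

Lower bound: for a Σ⁰₄ set A, guessing finite lists of witnesses turns ⟨n, m⟩ ∉ A into "for
infinitely many a there is b such that infinitely many r pass a decidable test"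
(`IsSigma.exists_stage`). The space for n has points p = ⟨0, m⟩ and q = ⟨1, m⟩, a middle point for
each d = ⟨m, ⟨a, b⟩⟩, and isolated points. Each passed test (r, e) for d yields one isolated point
near p and one near q, both also near the middle point of d. Approaching p or q means a → ∞;
approaching a middle point means r → ∞. So a middle point lies in the closures of both s-th
neighbourhoods exactly when s ≤ a and infinitely many r pass, which gives
`nearSpace.separated_pair_iff`. Any other two points are separated, and the space is always
Hausdorff because a fixed middle point has a fixed a. -/

theorem IsSigma.preimage {n : ℕ} {A : Set ℕ} (h : IsSigma n A) {f : ℕ → ℕ} (hf : Computable f) :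
    IsSigma n (f ⁻¹' A) := by
  induction n generalizing A f with
  | zero => exact ComputablePred.computable_of_manyOneReducible ⟨f, hf, fun _ => Iff.rfl⟩ h
  | succ n ih =>
    obtain ⟨B, hB, hA⟩ := h
    refine ⟨(fun z => Nat.pair (f z.unpair.1) z.unpair.2) ⁻¹' B, ?_, fun x => ?_⟩
    · refine ih hB (Primrec₂.natPair.to_comp.comp (hf.comp ?_) ?_)
      · exact (Primrec.fst.comp Primrec.unpair).to_comp
      · exact (Primrec.snd.comp Primrec.unpair).to_comp
    · simp [hA]

/-- A predicate on a primcodable type is `Σ⁰ₙ` if it is so on codes. -/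
def SigmaPred (n : ℕ) {α : Type*} [Primcodable α] (p : α → Prop) : Prop :=
  ∃ A : Set ℕ, IsSigma n A ∧ ∀ a, p a ↔ encode a ∈ A

/-- A predicate is `Π⁰ₙ` if its negation is `Σ⁰ₙ`. -/
def PiPred (n : ℕ) {α : Type*} [Primcodable α] (p : α → Prop) : Prop :=
  SigmaPred n fun a => ¬ p a

section Calculus

variable {α β : Type*} [Primcodable α] [Primcodable β] {n : ℕ}

theorem SigmaPred.of_eq {p q : α → Prop} (h : SigmaPred n p) (H : ∀ a, p a ↔ q a) :
    SigmaPred n q :=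
  (funext fun a => propext (H a) : p = q) ▸ h

theorem PiPred.of_eq {p q : α → Prop} (h : PiPred n p) (H : ∀ a, p a ↔ q a) : PiPred n q :=
  (funext fun a => propext (H a) : p = q) ▸ h

theorem SigmaPred.not {p : α → Prop} (h : SigmaPred n p) : PiPred n fun a => ¬ p a :=
  h.of_eq fun _ => not_not.symm

theorem SigmaPred.comp {p : β → Prop} (h : SigmaPred n p) {f : α → β} (hf : Computable f) :
    SigmaPred n fun a => p (f a) := by
  obtain ⟨A, hA, hp⟩ := h
  -- The default 0 at numbers that code nothing is harmless: only the values at codes matter.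
  refine ⟨_, hA.preimage (f := fun m => ((decode m : Option α).map fun a => encode (f a)).getD 0)
    ?_, fun a => by simp [hp]⟩
  exact Computable.option_getD
    (Computable.option_map Computable.decode (Computable.encode.comp (hf.comp Computable.snd)).to₂)
    (Computable.const 0)

theorem PiPred.comp {p : β → Prop} (h : PiPred n p) {f : α → β} (hf : Computable f) :
    PiPred n fun a => p (f a) :=
  SigmaPred.comp h hf

theorem sigmaPred_zero {p : α → Prop} : SigmaPred 0 p ↔ ComputablePred p := by
  constructor
  · rintro ⟨A, hA, hp⟩
    exact ComputablePred.computable_of_manyOneReducible ⟨encode, Computable.encode, hp⟩ hA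
  · intro h
    obtain ⟨f, hf, rfl⟩ := ComputablePred.computable_iff.1 h
    refine ⟨{m | ((decode m : Option α).map f).getD false}, ?_, fun a => by simp⟩
    refine ComputablePred.computable_iff.2 ⟨fun m => ((decode m : Option α).map f).getD false, ?_,
      rfl⟩
    exact Computable.option_getD
      (Computable.option_map Computable.decode (hf.comp Computable.snd).to₂) (Computable.const _)

theorem piPred_zero {p : α → Prop} : PiPred 0 p ↔ ComputablePred p := by
  refine sigmaPred_zero.trans ⟨fun h => h.not.of_eq fun _ => not_not, ComputablePred.not⟩

theorem sigmaPred_succ {p : α → Prop} :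
    SigmaPred (n + 1) p ↔ ∃ q : α × ℕ → Prop, PiPred n q ∧ ∀ a, p a ↔ ∃ y, q (a, y) := by
  constructor
  · rintro ⟨A, ⟨B, hB, hA⟩, hp⟩
    exact ⟨fun z => encode z ∈ B, ⟨Bᶜ, hB, fun _ => Iff.rfl⟩, fun a => (hp a).trans (hA _)⟩
  · rintro ⟨q, ⟨C, hC, hq⟩, hp⟩
    refine ⟨{x | ∃ y, Nat.pair x y ∈ Cᶜ}, ⟨Cᶜ, by rwa [compl_compl], fun _ => Iff.rfl⟩,
      fun a => (hp a).trans (exists_congr fun y => ?_)⟩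
    exact not_iff_not.1 ((hq (a, y)).trans not_not.symm)

theorem PiPred.exists {q : α × ℕ → Prop} (h : PiPred n q) :
    SigmaPred (n + 1) fun a => ∃ y, q (a, y) :=
  sigmaPred_succ.2 ⟨q, h, fun _ => Iff.rfl⟩

theorem SigmaPred.forall {q : α × ℕ → Prop} (h : SigmaPred n q) :
    PiPred (n + 1) fun a => ∀ y, q (a, y) :=
  h.not.exists.of_eq fun _ => not_forall.symm

theorem PiPred.sigma_succ {p : α → Prop} (h : PiPred n p) : SigmaPred (n + 1) p :=
  (h.comp (f := Prod.fst) Computable.fst).exists.of_eq fun _ => by simp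

theorem SigmaPred.pi_succ {p : α → Prop} (h : SigmaPred n p) : PiPred (n + 1) p :=
  PiPred.sigma_succ h.not

theorem SigmaPred.succ {p : α → Prop} (h : SigmaPred n p) : SigmaPred (n + 1) p := by
  induction n generalizing α with
  | zero => exact (piPred_zero.2 (sigmaPred_zero.1 h)).sigma_succ
  | succ n ih =>
    obtain ⟨q, hq, hp⟩ := sigmaPred_succ.1 h
    exact (PiPred.exists (n := n + 1) (ih hq)).of_eq fun a => (hp a).symm

theorem PiPred.succ {p : α → Prop} (h : PiPred n p) : PiPred (n + 1) p :=
  SigmaPred.succ h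

theorem SigmaPred.exists {q : α × ℕ → Prop} (h : SigmaPred (n + 1) q) :
    SigmaPred (n + 1) fun a => ∃ y, q (a, y) := by
  obtain ⟨r, hr, hq⟩ := sigmaPred_succ.1 h
  have hc : Computable fun w : α × ℕ => ((w.1, w.2.unpair.1), w.2.unpair.2) :=
    ((Primrec.fst.pair (Primrec.fst.comp (Primrec.unpair.comp Primrec.snd))).pair
      (Primrec.snd.comp (Primrec.unpair.comp Primrec.snd))).to_comp
  refine (hr.comp hc).exists.of_eq fun a => ?_
  simp only [hq]
  constructor
  · rintro ⟨w, hw⟩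
    exact ⟨_, _, hw⟩
  · rintro ⟨y, z, h⟩
    exact ⟨Nat.pair y z, by simpa using h⟩

theorem PiPred.forall {q : α × ℕ → Prop} (h : PiPred (n + 1) q) :
    PiPred (n + 1) fun a => ∀ y, q (a, y) :=
  (SigmaPred.exists h).of_eq fun _ => not_forall.symm

/-- The two connectives need a joint induction: passing to the Π⁰ₙ matrix exchanges them by De
Morgan. For the conjunction, the two witnesses are merged by pairing. -/
theorem SigmaPred.and_or {p q : α → Prop} (hp : SigmaPred n p) (hq : SigmaPred n q) :
    SigmaPred n (fun a => p a ∧ q a) ∧ SigmaPred n fun a => p a ∨ q a := by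
  induction n generalizing α with
  | zero =>
    obtain ⟨f, hf, rfl⟩ := ComputablePred.computable_iff.1 (sigmaPred_zero.1 hp)
    obtain ⟨g, hg, rfl⟩ := ComputablePred.computable_iff.1 (sigmaPred_zero.1 hq)
    constructor
    · exact sigmaPred_zero.2 (ComputablePred.computable_iff.2
        ⟨fun a => f a && g a, Primrec.and.to_comp.comp hf hg, by simp⟩)
    · exact sigmaPred_zero.2 (ComputablePred.computable_iff.2
        ⟨fun a => f a || g a, Primrec.or.to_comp.comp hf hg, by simp⟩)
  | succ n ih =>
    obtain ⟨r, hr, hp⟩ := sigmaPred_succ.1 hp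
    obtain ⟨s, hs, hq⟩ := sigmaPred_succ.1 hq
    constructor
    · have h₁ : Computable fun w : α × ℕ => (w.1, w.2.unpair.1) :=
        (Primrec.fst.pair (Primrec.fst.comp (Primrec.unpair.comp Primrec.snd))).to_comp
      have h₂ : Computable fun w : α × ℕ => (w.1, w.2.unpair.2) :=
        (Primrec.fst.pair (Primrec.snd.comp (Primrec.unpair.comp Primrec.snd))).to_comp
      have h : PiPred n fun w : α × ℕ => r (w.1, w.2.unpair.1) ∧ s (w.1, w.2.unpair.2) :=
        (ih (hr.comp h₁) (hs.comp h₂)).2.of_eq fun _ => not_and_or.symm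
      refine h.exists.of_eq fun a => ?_
      simp only [hp, hq]
      constructor
      · rintro ⟨w, h₁, h₂⟩
        exact ⟨⟨_, h₁⟩, ⟨_, h₂⟩⟩
      · rintro ⟨⟨y, hy⟩, ⟨z, hz⟩⟩
        exact ⟨Nat.pair y z, by simpa using ⟨hy, hz⟩⟩
    · have h : PiPred n fun w => r w ∨ s w := (ih hr hs).1.of_eq fun _ => not_or.symm
      refine h.exists.of_eq fun a => ?_
      simp only [hp, hq, exists_or]

theorem SigmaPred.and {p q : α → Prop} (hp : SigmaPred n p) (hq : SigmaPred n q) :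
    SigmaPred n fun a => p a ∧ q a :=
  (hp.and_or hq).1

theorem SigmaPred.or {p q : α → Prop} (hp : SigmaPred n p) (hq : SigmaPred n q) :
    SigmaPred n fun a => p a ∨ q a :=
  (hp.and_or hq).2

theorem PiPred.and {p q : α → Prop} (hp : PiPred n p) (hq : PiPred n q) :
    PiPred n fun a => p a ∧ q a :=
  (SigmaPred.or hp hq).of_eq fun _ => not_and_or.symm

theorem PiPred.or {p q : α → Prop} (hp : PiPred n p) (hq : PiPred n q) :
    PiPred n fun a => p a ∨ q a :=
  (SigmaPred.and hp hq).of_eq fun _ => not_or.symm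

end Calculus

theorem sigmaPred_iff_isSigma {n : ℕ} {A : Set ℕ} : SigmaPred n (fun x => x ∈ A) ↔ IsSigma n A := by
  constructor
  · rintro ⟨B, hB, h⟩
    rwa [show A = B from Set.ext h]
  · exact fun h => ⟨A, h, fun _ => Iff.rfl⟩

theorem piPred_iff_mem_piClass {n : ℕ} {A : Set ℕ} :
    PiPred n (fun x => x ∈ A) ↔ A ∈ PiClass n :=
  sigmaPred_iff_isSigma (A := Aᶜ)

/-- `Σ⁰₁` sets are domains of partial computable functions. -/
theorem IsSigma.exists_code {A : Set ℕ} (h : IsSigma 1 A) :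
    ∃ c : Code, ∀ x, x ∈ A ↔ ∃ k, (Code.evaln k c x).isSome := by
  obtain ⟨B, hB, hA⟩ := h
  obtain ⟨f, hf, hBf⟩ := ComputablePred.computable_iff.1
    ((ComputablePred.not (p := fun x => x ∈ Bᶜ) hB).of_eq fun x => not_not)
  have hpr : Partrec₂ fun (x y : ℕ) => (Part.some (f (Nat.pair x y)) : Part Bool) :=
    (hf.comp (Primrec₂.natPair.to_comp.comp Computable.fst Computable.snd)).partrec
  -- Unbounded search over a total test halts exactly when a witness exists.
  obtain ⟨c, hc⟩ := Code.exists_code.1 (Partrec.nat_iff.1 (Partrec.rfind hpr))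
  refine ⟨c, fun x => ?_⟩
  have : (∃ k, (Code.evaln k c x).isSome) ↔ (Code.eval c x).Dom := by
    simp only [Part.dom_iff_mem, Code.evaln_complete, Option.isSome_iff_exists, Option.mem_def]
    exact exists_comm
  rw [this, hc, hA]
  refine Iff.trans ?_ Nat.rfind_dom.symm
  have hB' : ∀ z, z ∈ B ↔ f z = true := fun z => iff_of_eq (congrFun hBf z)
  constructor
  · rintro ⟨y, hy⟩
    exact ⟨y, Part.mem_some_iff.2 ((hB' _).1 hy).symm, fun _ => trivial⟩
  · rintro ⟨y, hy, -⟩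
    exact ⟨y, (hB' _).2 (Part.mem_some_iff.1 hy).symm⟩

/-- Step-bounded evaluation is primitive recursive, so only the step bound has to be guessed. -/
theorem sigmaPred_mem_eval :
    SigmaPred 1 fun w : ℕ × ℕ × ℕ => w.2.2 ∈ Phi w.1 w.2.1 := by
  have hf : Primrec fun v : (ℕ × ℕ × ℕ) × ℕ =>
      (((v.2, Denumerable.ofNat Code v.1.1), v.1.2.1) : (ℕ × Code) × ℕ) :=
    (Primrec.snd.pair ((Primrec.ofNat Code).comp (Primrec.fst.comp Primrec.fst))).pair
      (Primrec.fst.comp (Primrec.snd.comp Primrec.fst))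
  have hg : Primrec fun v : (ℕ × ℕ × ℕ) × ℕ => some v.1.2.2 :=
    Primrec.option_some.comp (Primrec.snd.comp (Primrec.snd.comp Primrec.fst))
  have h : ComputablePred fun v : (ℕ × ℕ × ℕ) × ℕ =>
      Code.evaln v.2 (Denumerable.ofNat Code v.1.1) v.1.2.1 = some v.1.2.2 := by
    obtain ⟨_, h⟩ := PrimrecRel.comp Primrec.eq (Code.primrec_evaln.comp hf) hg
    exact ⟨_, h.to_comp⟩
  exact (piPred_zero.2 h).exists.of_eq fun w => by
    rw [Phi, Code.evaln_complete]
    rfl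

/-! ### Separation by closed neighbourhoods in terms of the base -/

namespace CSCSpace

variable (X : CSCSpace)

theorem mem_nhds_iff {x : X.Point} {s : Set X.Point} : s ∈ 𝓝 x ↔ ∃ i, x ∈ X.U i ∧ X.U i ⊆ s := by
  rw [X.isTopologicalBasis.mem_nhds_iff]
  constructor
  · rintro ⟨_, ⟨i, rfl⟩, h⟩
    exact ⟨i, h⟩
  · rintro ⟨i, h⟩
    exact ⟨_, ⟨i, rfl⟩, h⟩

theorem notMem_closure_iff {z : X.Point} {s : Set X.Point} :
    z ∉ closure s ↔ ∃ l, z ∈ X.U l ∧ ∀ w, w ∈ X.U l → w ∉ s := by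
  rw [← Set.mem_compl_iff, ← interior_compl, mem_interior_iff_mem_nhds, mem_nhds_iff]
  rfl

theorem separatedByClosedNhds_iff {x y : X.Point} :
    X.SeparatedByClosedNhds x y ↔ ∃ i j, x ∈ X.U i ∧ y ∈ X.U j ∧ ∀ z, ∃ l, z ∈ X.U l ∧
      ((∀ w, w ∈ X.U l → w ∉ X.U i) ∨ ∀ w, w ∈ X.U l → w ∉ X.U j) := by
  constructor
  · rintro ⟨C, hC, D, hD, hCc, hDc, hCD⟩
    obtain ⟨i, hxi, hi⟩ := X.mem_nhds_iff.1 hC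
    obtain ⟨j, hyj, hj⟩ := X.mem_nhds_iff.1 hD
    refine ⟨i, j, hxi, hyj, fun z => ?_⟩
    by_cases hz : z ∈ C
    · obtain ⟨l, hl, h⟩ := X.mem_nhds_iff.1
        (hDc.isOpen_compl.mem_nhds (Set.disjoint_left.1 hCD hz))
      exact ⟨l, hl, Or.inr fun w hw hwj => h hw (hj hwj)⟩
    · obtain ⟨l, hl, h⟩ := X.mem_nhds_iff.1 (hCc.isOpen_compl.mem_nhds hz)
      exact ⟨l, hl, Or.inl fun w hw hwi => h hw (hi hwi)⟩
  · rintro ⟨i, j, hx, hy, h⟩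
    refine ⟨closure (X := X.Point) (X.U i), X.mem_nhds_iff.2 ⟨i, hx, subset_closure (X := X.Point)⟩,
      closure (X := X.Point) (X.U j), X.mem_nhds_iff.2 ⟨j, hy, subset_closure (X := X.Point)⟩,
      isClosed_closure, isClosed_closure, Set.disjoint_left.2 fun z hzi hzj => ?_⟩
    obtain ⟨l, hl, h | h⟩ := h z
    · exact X.notMem_closure_iff.2 ⟨l, hl, h⟩ hzi
    · exact X.notMem_closure_iff.2 ⟨l, hl, h⟩ hzj

theorem SeparatedByClosedNhds.symm {X : CSCSpace} {x y : X.Point}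
    (h : X.SeparatedByClosedNhds x y) : X.SeparatedByClosedNhds y x := by
  obtain ⟨C, hC, D, hD, hC', hD', h⟩ := h
  exact ⟨D, hD, C, hC, hD', hC', h.symm⟩

theorem t25Space_iff :
    T25Space X.Point ↔ ∀ x y : X.Point, x ≠ y → X.SeparatedByClosedNhds x y := by
  constructor
  · intro _ x y hxy
    obtain ⟨s, hs, t, ht, h⟩ := exists_nhds_disjoint_closure hxy
    exact ⟨closure s, Filter.mem_of_superset hs subset_closure, closure t,
      Filter.mem_of_superset ht subset_closure, isClosed_closure, isClosed_closure, h⟩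
  · refine fun h => ⟨fun x y hxy => ?_⟩
    obtain ⟨C, hC, D, hD, hCc, hDc, hCD⟩ := h x y hxy
    refine Filter.disjoint_iff.2 ⟨C, ?_, D, ?_, hCD⟩
    · simpa only [hCc.closure_eq] using Filter.mem_lift' (h := closure) hC
    · simpa only [hDc.closure_eq] using Filter.mem_lift' (h := closure) hD

end CSCSpace

/-! ### The index set of the Urysohn spaces is `Π⁰₅` -/

/-- The machine `Φ_m` of the index `e = ⟨m, n⟩` accepts `⟨i, x⟩`. -/
def CodedMem (e i x : ℕ) : Prop := 1 ∈ Phi e.unpair.1 (Nat.pair i x)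

theorem IsIndex.mem_iff {e : ℕ} {X : CSCSpace} (h : IsIndex e X) {i x : ℕ} :
    x ∈ X.U i ↔ CodedMem e i x :=
  ⟨h.of_mem i x, fun h₁ => by_contra fun hx =>
    absurd (Part.mem_unique h₁ (h.of_notMem i x hx)) one_ne_zero⟩

theorem IsIndex.k_eq {e : ℕ} {X : CSCSpace} (h : IsIndex e X) {i j x r : ℕ}
    (hr : r ∈ Phi e.unpair.2 (Nat.pair i (Nat.pair j x))) : X.k i j x = r :=
  Part.mem_unique (h.computes_k i j x) hr

/-- This lets hardness pass from the constructed space to whatever space witnesses membership in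
`T25CSC`. -/
theorem IsIndex.unique {e : ℕ} {X Y : CSCSpace} (hX : IsIndex e X) (hY : IsIndex e Y) : X = Y := by
  have hU : X.U = Y.U := funext fun i => Set.ext fun x => hX.mem_iff.trans hY.mem_iff.symm
  have hk : X.k = Y.k := funext fun i => funext fun j => funext fun x =>
    hX.k_eq (hY.computes_k i j x)
  cases X; cases Y; cases hU; cases hk; rfl

/-- Implications are written as disjunctions so that the quantifier calculus applies; `k` is
recovered by choosing the values r. -/
theorem exists_isIndex_iff {e : ℕ} : (∃ X, IsIndex e X) ↔
    (∀ i x, CodedMem e i x ∨ 0 ∈ Phi e.unpair.1 (Nat.pair i x)) ∧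
    (∀ x, ∃ i, CodedMem e i x) ∧
    ∀ i j x, ∃ r, r ∈ Phi e.unpair.2 (Nat.pair i (Nat.pair j x)) ∧
      (¬ (CodedMem e i x ∧ CodedMem e j x) ∨
        (CodedMem e r x ∧ ∀ y, ¬ CodedMem e r y ∨ (CodedMem e i y ∧ CodedMem e j y))) := by
  constructor
  · rintro ⟨X, hX⟩
    refine ⟨fun i x => ?_, fun x => ?_, fun i j x => ⟨X.k i j x, hX.computes_k i j x, ?_⟩⟩
    · by_cases hx : x ∈ X.U i
      · exact Or.inl (hX.of_mem i x hx)
      · exact Or.inr (hX.of_notMem i x hx)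
    · exact (X.cover x).imp fun i => hX.mem_iff.1
    · simp only [← hX.mem_iff]
      by_cases hx : x ∈ X.U i ∩ X.U j
      · exact Or.inr ⟨X.mem_k i j x hx, fun y => or_iff_not_imp_left.2 fun hy =>
          X.k_subset i j x hx (not_not.1 hy)⟩
      · exact Or.inl hx
  · rintro ⟨h₁, h₂, h₃⟩
    choose k hk hU using h₃
    refine ⟨⟨fun i => {x | CodedMem e i x}, k, h₂, fun i j x hx => ?_, fun i j x hx y hy => ?_⟩,
      fun i x hx => hx, fun i x hx => (h₁ i x).resolve_left hx, hk⟩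
    · exact ((hU i j x).resolve_left (not_not.2 hx)).1
    · exact (((hU i j x).resolve_left (not_not.2 hx)).2 y).resolve_left (not_not.2 hy)

theorem mem_T25CSC_iff {e : ℕ} : e ∈ T25CSC ↔ (∃ X, IsIndex e X) ∧
    ∀ x y, x = y ∨ ∃ i j, CodedMem e i x ∧ CodedMem e j y ∧ ∀ z, ∃ l, CodedMem e l z ∧
      ((∀ w, ¬ (CodedMem e l w ∧ CodedMem e i w)) ∨
        ∀ w, ¬ (CodedMem e l w ∧ CodedMem e j w)) := by
  have key : ∀ X : CSCSpace, IsIndex e X → (T25Space X.Point ↔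
      ∀ x y, x = y ∨ ∃ i j, CodedMem e i x ∧ CodedMem e j y ∧ ∀ z, ∃ l, CodedMem e l z ∧
      ((∀ w, ¬ (CodedMem e l w ∧ CodedMem e i w)) ∨
        ∀ w, ¬ (CodedMem e l w ∧ CodedMem e j w))) := by
    intro X hX
    simp only [X.t25Space_iff, X.separatedByClosedNhds_iff, ← hX.mem_iff, or_iff_not_imp_left,
      not_and]
    rfl
  constructor
  · rintro ⟨X, hX, h⟩
    exact ⟨⟨X, hX⟩, (key X hX).1 h⟩
  · rintro ⟨⟨X, hX⟩, h⟩
    exact ⟨X, hX, (key X hX).2 h⟩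

section Complexity

variable {α : Type*} [Primcodable α]

theorem sigmaPred_mem_Phi {f g h : α → ℕ} (hf : Computable f) (hg : Computable g)
    (hh : Computable h) : SigmaPred 1 fun a => h a ∈ Phi (f a) (g a) :=
  sigmaPred_mem_eval.comp (f := fun a => (f a, g a, h a)) (hf.pair (hg.pair hh))

theorem sigmaPred_codedMem {f g h : α → ℕ} (hf : Computable f) (hg : Computable g)
    (hh : Computable h) : SigmaPred 1 fun a => CodedMem (f a) (g a) (h a) :=
  sigmaPred_mem_Phi ((Computable.fst.comp Computable.unpair).comp hf)
    (Primrec₂.natPair.to_comp.comp hg hh) (Computable.const 1)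

end Complexity

theorem piPred_exists_isIndex : PiPred 4 fun e => ∃ X, IsIndex e X := by
  have c₁ : Computable (Prod.fst : ℕ × ℕ → ℕ) := Computable.fst
  have c₂ : Computable (fun v : (ℕ × ℕ) × ℕ => v.1.1) := c₁.comp Computable.fst
  have c₃ : Computable (fun v : ((ℕ × ℕ) × ℕ) × ℕ => v.1.1.1) := c₂.comp Computable.fst
  have c₄ : Computable (fun v : (((ℕ × ℕ) × ℕ) × ℕ) × ℕ => v.1.1.1.1) := c₃.comp Computable.fst
  have c₅ : Computable (fun v : ((((ℕ × ℕ) × ℕ) × ℕ) × ℕ) × ℕ => v.1.1.1.1.1) :=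
    c₄.comp Computable.fst
  have d₁ : Computable (Prod.snd : ℕ × ℕ → ℕ) := Computable.snd
  have d₂ : Computable (fun v : (ℕ × ℕ) × ℕ => v.1.2) := d₁.comp Computable.fst
  have d₃ : Computable (fun v : ((ℕ × ℕ) × ℕ) × ℕ => v.1.1.2) := d₂.comp Computable.fst
  have d₄ : Computable (fun v : (((ℕ × ℕ) × ℕ) × ℕ) × ℕ => v.1.1.1.2) := d₃.comp Computable.fst
  have d₅ : Computable (fun v : ((((ℕ × ℕ) × ℕ) × ℕ) × ℕ) × ℕ => v.1.1.1.1.2) :=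
    d₄.comp Computable.fst
  have h₁ : PiPred 2 fun e : ℕ => ∀ i x, CodedMem e i x ∨ 0 ∈ Phi e.unpair.1 (Nat.pair i x) := by
    have : SigmaPred 1 fun v : (ℕ × ℕ) × ℕ =>
        CodedMem v.1.1 v.1.2 v.2 ∨ 0 ∈ Phi v.1.1.unpair.1 (Nat.pair v.1.2 v.2) :=
      (sigmaPred_codedMem c₂ d₂ Computable.snd).or (sigmaPred_mem_Phi
        ((Computable.fst.comp Computable.unpair).comp c₂)
        (Primrec₂.natPair.to_comp.comp d₂ Computable.snd) (Computable.const 0))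
    exact this.forall.forall
  have h₂ : PiPred 2 fun e : ℕ => ∀ x, ∃ i, CodedMem e i x := by
    have : SigmaPred 1 fun v : (ℕ × ℕ) × ℕ => CodedMem v.1.1 v.2 v.1.2 :=
      sigmaPred_codedMem c₂ Computable.snd d₂
    exact this.exists.forall
  have h₃ : PiPred 4 fun e : ℕ =>
      ∀ i j x, ∃ r, r ∈ Phi e.unpair.2 (Nat.pair i (Nat.pair j x)) ∧
      (¬ (CodedMem e i x ∧ CodedMem e j x) ∨
        (CodedMem e r x ∧ ∀ y, ¬ CodedMem e r y ∨ (CodedMem e i y ∧ CodedMem e j y))) := by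
    have a₁ : SigmaPred 1 fun v : (((ℕ × ℕ) × ℕ) × ℕ) × ℕ => v.2 ∈
        Phi v.1.1.1.1.unpair.2 (Nat.pair v.1.1.1.2 (Nat.pair v.1.1.2 v.1.2)) :=
      sigmaPred_mem_Phi ((Computable.snd.comp Computable.unpair).comp c₄)
        (Primrec₂.natPair.to_comp.comp d₄
          (Primrec₂.natPair.to_comp.comp (Computable.snd.comp (Computable.fst.comp Computable.fst))
            (Computable.snd.comp Computable.fst))) Computable.snd
    have a₂ : SigmaPred 1 fun v : (((ℕ × ℕ) × ℕ) × ℕ) × ℕ =>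
        CodedMem v.1.1.1.1 v.1.1.1.2 v.1.2 ∧ CodedMem v.1.1.1.1 v.1.1.2 v.1.2 :=
      (sigmaPred_codedMem c₄ d₄ (Computable.snd.comp Computable.fst)).and
        (sigmaPred_codedMem c₄ (Computable.snd.comp (Computable.fst.comp Computable.fst))
          (Computable.snd.comp Computable.fst))
    have a₃ : SigmaPred 1 fun v : (((ℕ × ℕ) × ℕ) × ℕ) × ℕ => CodedMem v.1.1.1.1 v.2 v.1.2 :=
      sigmaPred_codedMem c₄ Computable.snd (Computable.snd.comp Computable.fst)
    have a₄ : SigmaPred 1 fun v : ((((ℕ × ℕ) × ℕ) × ℕ) × ℕ) × ℕ =>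
        CodedMem v.1.1.1.1.1 v.1.2 v.2 :=
      sigmaPred_codedMem c₅ (Computable.snd.comp Computable.fst) Computable.snd
    have a₅ : SigmaPred 1 fun v : ((((ℕ × ℕ) × ℕ) × ℕ) × ℕ) × ℕ =>
        CodedMem v.1.1.1.1.1 v.1.1.1.1.2 v.2 ∧ CodedMem v.1.1.1.1.1 v.1.1.1.2 v.2 :=
      (sigmaPred_codedMem c₅ d₅ Computable.snd).and
        (sigmaPred_codedMem c₅ (Computable.snd.comp
          (Computable.fst.comp (Computable.fst.comp Computable.fst))) Computable.snd)
    -- Deliberately crude: the matrix is Π⁰₂, ∃ r makes it Σ⁰₃, and the outer quantifiers Π⁰₄.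
    exact (a₁.pi_succ.and (a₂.not.succ.or
      (a₃.pi_succ.and (a₄.not.succ.or a₅.pi_succ).forall))).exists.forall.forall.forall
  exact ((h₁.succ.succ.and (h₂.succ.succ.and h₃))).of_eq fun e => exists_isIndex_iff.symm

theorem T25CSC_mem_piClass : T25CSC ∈ PiClass 5 := by
  have c₃ : Computable (fun v : ((ℕ × ℕ) × ℕ) × ℕ => v.1.1.1) :=
    Computable.fst.comp (Computable.fst.comp Computable.fst)
  have c₄ : Computable (fun v : (((ℕ × ℕ) × ℕ) × ℕ) × ℕ => v.1.1.1.1) := c₃.comp Computable.fst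
  have c₆ : Computable (fun v : (((((ℕ × ℕ) × ℕ) × ℕ) × ℕ) × ℕ) × ℕ => v.1.1.1.1.1.1) :=
    c₄.comp (Computable.fst.comp Computable.fst)
  have c₇ : Computable (fun v : ((((((ℕ × ℕ) × ℕ) × ℕ) × ℕ) × ℕ) × ℕ) × ℕ => v.1.1.1.1.1.1.1) :=
    c₆.comp Computable.fst
  have hw (α : Type) [Primcodable α] : Computable fun v : α × ℕ => v.2 := Computable.snd
  have hl (α : Type) [Primcodable α] : Computable fun v : (α × ℕ) × ℕ => v.1.2 :=
    Computable.snd.comp Computable.fst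
  have hj (α : Type) [Primcodable α] : Computable fun v : (((α × ℕ) × ℕ) × ℕ) × ℕ => v.1.1.1.2 :=
    (hl α).comp (Computable.fst.comp Computable.fst)
  have hi (α : Type) [Primcodable α] :
      Computable fun v : ((((α × ℕ) × ℕ) × ℕ) × ℕ) × ℕ => v.1.1.1.1.2 :=
    (hj α).comp Computable.fst
  have a₁ : PiPred 1 fun v : ((((((ℕ × ℕ) × ℕ) × ℕ) × ℕ) × ℕ) × ℕ) × ℕ =>
      ¬ (CodedMem v.1.1.1.1.1.1.1 v.1.2 v.2 ∧ CodedMem v.1.1.1.1.1.1.1 v.1.1.1.1.2 v.2) :=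
    ((sigmaPred_codedMem c₇ (hl _) (hw _)).and (sigmaPred_codedMem c₇ (hi _) (hw _))).not
  have a₂ : PiPred 1 fun v : ((((((ℕ × ℕ) × ℕ) × ℕ) × ℕ) × ℕ) × ℕ) × ℕ =>
      ¬ (CodedMem v.1.1.1.1.1.1.1 v.1.2 v.2 ∧ CodedMem v.1.1.1.1.1.1.1 v.1.1.1.2 v.2) :=
    ((sigmaPred_codedMem c₇ (hl _) (hw _)).and (sigmaPred_codedMem c₇ (hj _) (hw _))).not
  have a₃ : SigmaPred 1 fun v : (((((ℕ × ℕ) × ℕ) × ℕ) × ℕ) × ℕ) × ℕ =>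
      CodedMem v.1.1.1.1.1.1 v.2 v.1.2 :=
    sigmaPred_codedMem c₆ (hw _) (hl _)
  have a₄ : SigmaPred 1 fun v : (((ℕ × ℕ) × ℕ) × ℕ) × ℕ => CodedMem v.1.1.1.1 v.1.2 v.1.1.1.2 :=
    sigmaPred_codedMem c₄ (hl _) (hj _)
  have a₅ : SigmaPred 1 fun v : (((ℕ × ℕ) × ℕ) × ℕ) × ℕ => CodedMem v.1.1.1.1 v.2 v.1.1.2 :=
    sigmaPred_codedMem c₄ (hw _) ((hl _).comp Computable.fst)
  have a₆ : SigmaPred 0 fun v : (ℕ × ℕ) × ℕ => v.1.2 = v.2 := by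
    obtain ⟨_, h⟩ := PrimrecRel.comp Primrec.eq
      ((Primrec.snd.comp Primrec.fst : Primrec fun v : (ℕ × ℕ) × ℕ => v.1.2)) Primrec.snd
    exact sigmaPred_zero.2 ⟨_, h.to_comp⟩
  -- The levels are Σ⁰₂ after ∃ l, Π⁰₃ after ∀ z, Σ⁰₄ after ∃ i j, and Π⁰₅ after ∀ x y.
  have b₁ := (a₃.succ.and (a₁.forall.or a₂.forall).sigma_succ).exists.forall
  have b₂ := (a₄.pi_succ.succ.and (a₅.pi_succ.succ.and b₁)).exists.exists
  have b₃ := (a₆.succ.succ.succ.succ.or b₂).forall.forall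
  exact piPred_iff_mem_piClass.1
    ((piPred_exists_isIndex.succ.and b₃).of_eq fun e => mem_T25CSC_iff.symm)

/-! ### A normal form for `Σ⁰₄` sets -/

theorem IsSigma.exists_code_four {A : Set ℕ} (h : IsSigma 4 A) : ∃ c : Code, ∀ x, x ∉ A ↔
    ∀ y, ∃ w, ∀ z, ∃ k, (Code.evaln k c (Nat.pair (Nat.pair (Nat.pair x y) w) z)).isSome := by
  obtain ⟨B, ⟨B', ⟨B'', hB'', h₂⟩, h₁⟩, h₀⟩ := h
  obtain ⟨c, hc⟩ := IsSigma.exists_code hB''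
  refine ⟨c, fun x => ?_⟩
  rw [h₀, not_exists]
  refine forall_congr' fun y => (h₁ _).trans (exists_congr fun w => ?_)
  rw [← not_iff_not, ← Set.mem_compl_iff, h₂, not_forall]
  exact exists_congr fun z => not_not.symm.trans (not_congr (hc _))

/-- The `i`-th entry of the list coded by `b`, or `0`. -/
def codedEntry (b i : ℕ) : ℕ := (Denumerable.ofNat (List ℕ) b).getD i 0

theorem exists_codedEntry_eq (w : ℕ → ℕ) (n : ℕ) : ∃ b, ∀ i < n, codedEntry b i = w i := by
  refine ⟨encode ((List.range n).map w), fun i hi => ?_⟩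
  simp [codedEntry, List.getD_eq_getElem?_getD, hi]

/-- Forwards, b codes an initial segment of a Skolem function, and monotonicity lets one bound e
serve finitely many tests. Backwards, the y-th entry of a list b with a ≥ y is a witness for y,
since infinitely many r cover every z. -/
theorem forall_exists_forall_exists_iff {S : ℕ → ℕ → ℕ → ℕ → Prop}
    (hS : ∀ y w z k l, k ≤ l → S y w z k → S y w z l) :
    (∀ y, ∃ w, ∀ z, ∃ k, S y w z k) ↔ ∀ s, ∃ a ≥ s, ∃ b, ∀ r, ∃ c ≥ r, ∃ e,
      ∀ y < a + 1, ∀ z < c + 1, S y (codedEntry b y) z e := by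
  constructor
  · intro h s
    choose w k hk using h
    obtain ⟨b, hb⟩ := exists_codedEntry_eq w (s + 1)
    refine ⟨s, le_rfl, b, fun r => ⟨r, le_rfl,
      (Finset.range (s + 1) ×ˢ Finset.range (r + 1)).sup fun v => k v.1 v.2, fun y hy z hz => ?_⟩⟩
    rw [hb y hy]
    refine hS _ _ _ _ _ ?_ (hk y z)
    exact Finset.le_sup (f := fun v : ℕ × ℕ => k v.1 v.2) (b := (y, z)) (by simp; omega)
  · intro h y
    obtain ⟨a, ha, b, hb⟩ := h y
    refine ⟨codedEntry b y, fun z => ?_⟩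
    obtain ⟨c, hc, e, he⟩ := hb z
    exact ⟨e, he y (by omega) z (by omega)⟩

/-- `(d, t)` is a stage witnessing, for `d = ⟨m, ⟨a, b⟩⟩` and `t = ⟨r, e⟩`, that the first `a + 1`
entries of `b` pass the first `r + 1` tests within `e` steps. -/
def Stage (c : Code) (n d t : ℕ) : Prop :=
  ∀ y < d.unpair.2.unpair.1 + 1, ∀ z < t.unpair.1 + 1, (Code.evaln t.unpair.2 c
    (Nat.pair (Nat.pair (Nat.pair (Nat.pair n d.unpair.1) y)
      (codedEntry d.unpair.2.unpair.2 y)) z)).isSome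

theorem IsSigma.exists_stage {A : Set ℕ} (h : IsSigma 4 A) : ∃ c : Code, ∀ n m,
    Nat.pair n m ∈ A ↔ ∃ s, ∀ a ≥ s, ∀ b, ∃ r, ∀ r' ≥ r, ∀ e,
      ¬ Stage c n (Nat.pair m (Nat.pair a b)) (Nat.pair r' e) := by
  obtain ⟨c, hc⟩ := h.exists_code_four
  refine ⟨c, fun n m => ?_⟩
  rw [← not_iff_not, hc, forall_exists_forall_exists_iff]
  · push Not
    simp only [Stage, Nat.unpair_pair]
  · intro y w z k l hkl hk
    obtain ⟨v, hv⟩ := Option.isSome_iff_exists.1 hk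
    exact Option.isSome_iff_exists.2 ⟨v, Code.evaln_mono hkl hv⟩

/-! ### The spaces -/

/-- `y` lies in the `s`-th neighbourhood of `x` without being `x`.  Points are pairs `⟨i, d⟩`.  The
points with `3 ≤ i` will be isolated.  Those with `i = 0, 1` are the pairs to be separated. Those
with `i = 2` are the possible common points of the closures of their neighbourhoods. -/
def Near (R : ℕ → ℕ → Prop) (x s y : ℕ) : Prop :=
  ((x.unpair.1 ≤ 1 ∧ y.unpair.1 = x.unpair.1 + 3) ∧
    y.unpair.2.unpair.1.unpair.1 = x.unpair.2 ∧ s ≤ y.unpair.2.unpair.1.unpair.2.unpair.1 ∧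
    R y.unpair.2.unpair.1 y.unpair.2.unpair.2) ∨
  ((x.unpair.1 = 2 ∧ 3 ≤ y.unpair.1) ∧
    y.unpair.2.unpair.1 = x.unpair.2 ∧ s ≤ y.unpair.2.unpair.2.unpair.1)

section Near

variable {R : ℕ → ℕ → Prop} {x y z w s t : ℕ}

theorem Near.mono (h : Near R x t y) (hst : s ≤ t) : Near R x s y := by
  obtain ⟨h₁, h₂, h₃, h₄⟩ | ⟨h₁, h₂, h₃⟩ := h
  · exact Or.inl ⟨h₁, h₂, hst.trans h₃, h₄⟩
  · exact Or.inr ⟨h₁, h₂, hst.trans h₃⟩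

theorem Near.left_le (h : Near R x s y) : x.unpair.1 ≤ 2 := by
  obtain ⟨h₁, -⟩ | ⟨h₁, -⟩ := h <;> omega

theorem Near.le_right (h : Near R x s y) : 3 ≤ y.unpair.1 := by
  obtain ⟨h₁, -⟩ | ⟨h₁, -⟩ := h <;> omega

theorem Near.not_near (h : Near R x s y) : ¬ Near R y t z := fun h' => by
  have := h.le_right
  have := h'.left_le
  omega

/-- The bound on s is a component of y, and pairing dominates components. Hence a neighbourhood with
s > y omits y unless y is its centre. -/
theorem Near.le (h : Near R x s y) : s ≤ y := by
  obtain ⟨-, -, h₃, -⟩ | ⟨-, -, h₃⟩ := h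
  · exact h₃.trans ((Nat.unpair_left_le _).trans ((Nat.unpair_right_le _).trans
      ((Nat.unpair_left_le _).trans (Nat.unpair_right_le _))))
  · exact h₃.trans ((Nat.unpair_left_le _).trans
      ((Nat.unpair_right_le _).trans (Nat.unpair_right_le _)))

theorem ext_unpair (h₁ : x.unpair.1 = y.unpair.1) (h₂ : x.unpair.2 = y.unpair.2) : x = y := by
  rw [← Nat.pair_unpair x, ← Nat.pair_unpair y, h₁, h₂]

/-- Distinct points with a common near point are of different kinds. -/
theorem Near.kinds (hx : Near R x s w) (hy : Near R y t w) (hxy : x ≠ y) :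
    (x.unpair.1 = 2 ∧ y.unpair.1 ≤ 1 ∧ t ≤ x) ∨ (y.unpair.1 = 2 ∧ x.unpair.1 ≤ 1 ∧ s ≤ y) := by
  have hle (v : ℕ) : v.unpair.2.unpair.2.unpair.1 ≤ v :=
    (Nat.unpair_left_le _).trans ((Nat.unpair_right_le _).trans (Nat.unpair_right_le _))
  obtain ⟨h₁, h₂, h₃, -⟩ | ⟨h₁, h₂, h₃⟩ := hx <;> obtain ⟨k₁, k₂, k₃, -⟩ | ⟨k₁, k₂, k₃⟩ := hy
  -- A near point records the kind and the index of a centre of kind 0 or 1, so these centres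
  -- coincide.
  · exact absurd (ext_unpair (by omega) (by omega)) hxy
  -- In the mixed case the near point stores d, the index of the middle point, and s is at most the
  -- entry a of d.
  · refine Or.inr ⟨k₁.1, h₁.1, h₃.trans ?_⟩
    rw [k₂]
    exact hle y
  · refine Or.inl ⟨h₁.1, k₁.1, k₃.trans ?_⟩
    rw [h₂]
    exact hle x
  · exact absurd (ext_unpair (by omega) (by omega)) hxy

end Near

/-- The space in which `⟨x, s⟩` codes the basic open set of `x` and the points near to it at `s`. -/
def nearSpace (R : ℕ → ℕ → Prop) : CSCSpace where
  U i := {y | y = i.unpair.1 ∨ Near R i.unpair.1 i.unpair.2 y}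
  k i j y := Nat.pair y (max i.unpair.2 j.unpair.2)
  cover x := ⟨Nat.pair x 0, by simp⟩
  mem_k i j x _ := by simp
  k_subset i j x hx y hy := by
    -- If x is the centre of U i, monotonicity suffices; otherwise x is a near point, which has no
    -- near points itself, so its own basic sets are {x}.
    have key : ∀ (i : ℕ) (s : ℕ), i.unpair.2 ≤ s → (x = i.unpair.1 ∨ Near R i.unpair.1 i.unpair.2 x) →
        (y = x ∨ Near R x s y) → (y = i.unpair.1 ∨ Near R i.unpair.1 i.unpair.2 y) := by
      rintro i s hs hx (rfl | hy)
      · exact hx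
      · obtain rfl | hx := hx
        · exact Or.inr (hy.mono hs)
        · exact absurd hy hx.not_near
    simp only [Set.mem_ofPred_eq, Nat.unpair_pair] at hy
    exact ⟨key i _ (le_max_left _ _) hx.1 hy, key j _ (le_max_right _ _) hx.2 hy⟩

namespace nearSpace

variable {R : ℕ → ℕ → Prop}

theorem mem_U {x s y : ℕ} : y ∈ (nearSpace R).U (Nat.pair x s) ↔ y = x ∨ Near R x s y := by
  simp [nearSpace]

/-- Taking s above both codes rules out one centre being near the other, by `Near.le`, and the mixed
case of `Near.kinds`. -/
theorem disjoint_of_ne {x y s : ℕ} (hxy : x ≠ y) (hx : x < s) (hy : y < s) {w : ℕ}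
    (h₁ : w ∈ (nearSpace R).U (Nat.pair x s)) : w ∉ (nearSpace R).U (Nat.pair y s) := by
  rw [mem_U] at h₁ ⊢
  rintro (rfl | h₂)
  · obtain rfl | h₁ := h₁
    · exact hxy rfl
    · exact absurd h₁.le (by omega)
  · obtain rfl | h₁ := h₁
    · exact absurd h₂.le (by omega)
    · have := h₁.kinds h₂ hxy
      omega

theorem t2Space (R : ℕ → ℕ → Prop) : T2Space (nearSpace R).Point := by
  refine t2Space_iff_disjoint_nhds.2 fun x y hxy => ?_
  let x' : ℕ := x
  let y' : ℕ := y
  refine Filter.disjoint_iff.2 ⟨(nearSpace R).U (Nat.pair x' (x' + y' + 1)),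
    (nearSpace R).mem_nhds_iff.2 ⟨_, mem_U.2 (Or.inl rfl), subset_rfl⟩,
    (nearSpace R).U (Nat.pair y' (x' + y' + 1)),
    (nearSpace R).mem_nhds_iff.2 ⟨_, mem_U.2 (Or.inl rfl), subset_rfl⟩, ?_⟩
  exact Set.disjoint_left.2 fun w =>
    disjoint_of_ne (x := x') (y := y') hxy (by omega) (by omega)

/-- A point at which small neighbourhoods of `x` and of `y` accumulate has the middle kind. -/
theorem kind_of_common {x y z s l w w' : ℕ} (hxy : x ≠ y) (hx : x < s) (hy : y < s)
    (hzx : z ≠ x) (hzy : z ≠ y) (hz : z < l) (hs : s < l)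
    (h₁ : w ∈ (nearSpace R).U (Nat.pair z l)) (h₂ : w ∈ (nearSpace R).U (Nat.pair x s))
    (h₃ : w' ∈ (nearSpace R).U (Nat.pair z l)) (h₄ : w' ∈ (nearSpace R).U (Nat.pair y s)) :
    z.unpair.1 = 2 ∧ Near R z l w ∧ Near R x s w ∧ x.unpair.1 ≤ 1 ∧
      Near R z l w' ∧ Near R y s w' ∧ y.unpair.1 ≤ 1 := by
  have key : ∀ {x y w w'}, x ≠ y → x < s → y < s → z ≠ x → z ≠ y →
      w ∈ (nearSpace R).U (Nat.pair z l) → w ∈ (nearSpace R).U (Nat.pair x s) →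
      w' ∈ (nearSpace R).U (Nat.pair z l) → w' ∈ (nearSpace R).U (Nat.pair y s) →
      z.unpair.1 = 2 ∧ Near R z l w ∧ Near R x s w ∧ x.unpair.1 ≤ 1 := by
    intro x y w w' hxy hx hy hzx hzy h₁ h₂ h₃ h₄
    -- Were w = z, then z would be near x, hence isolated; so w' = z too, putting z in two disjoint
    -- neighbourhoods.
    have hzw : Near R z l w := by
      refine (mem_U.1 h₁).resolve_left ?_
      rintro rfl
      have hw := (mem_U.1 h₂).resolve_left hzx
      obtain rfl | h₃ := mem_U.1 h₃
      · exact disjoint_of_ne hxy hx hy h₂ h₄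
      · exact hw.not_near h₃
    have hxw : Near R x s w := by
      refine (mem_U.1 h₂).resolve_left ?_
      rintro rfl
      exact absurd hzw.le (by omega)
    have := hzw.kinds hxw hzx
    refine ⟨?_, hzw, hxw, ?_⟩ <;> omega
  obtain ⟨a₁, a₂, a₃, a₄⟩ := key hxy hx hy hzx hzy h₁ h₂ h₃ h₄
  obtain ⟨-, b₂, b₃, b₄⟩ := key hxy.symm hy hx hzy hzx h₃ h₄ h₁ h₂
  exact ⟨a₁, a₂, a₃, a₄, b₂, b₃, b₄⟩

/-- A criterion for separation that only looks at points of the middle kind. -/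
theorem separated_of {x y s : ℕ} (hxy : x ≠ y) (hx : x < s) (hy : y < s)
    (h : ∀ z, z.unpair.1 = 2 → ∃ r, ∀ l ≥ r, ∀ w w', Near R z l w → Near R x s w →
      x.unpair.1 ≤ 1 → Near R z l w' → Near R y s w' → y.unpair.1 ≤ 1 → False) :
    (nearSpace R).SeparatedByClosedNhds x y := by
  refine (nearSpace R).separatedByClosedNhds_iff.2
    ⟨Nat.pair x s, Nat.pair y s, mem_U.2 (Or.inl rfl), mem_U.2 (Or.inl rfl), fun z => ?_⟩
  change ℕ at z
  by_cases hzx : z = x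
  · exact ⟨Nat.pair x s, mem_U.2 (Or.inl hzx), Or.inr fun w => disjoint_of_ne hxy hx hy⟩
  by_cases hzy : z = y
  · exact ⟨Nat.pair y s, mem_U.2 (Or.inl hzy), Or.inl fun w => disjoint_of_ne hxy.symm hy hx⟩
  obtain ⟨r, hr⟩ : ∃ r, z.unpair.1 = 2 → ∀ l ≥ r, ∀ w w', Near R z l w → Near R x s w →
      x.unpair.1 ≤ 1 → Near R z l w' → Near R y s w' → y.unpair.1 ≤ 1 → False := by
    by_cases hz : z.unpair.1 = 2
    · exact (h z hz).imp fun r hr _ => hr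
    · exact ⟨0, fun hz' => absurd hz' hz⟩
  -- The radius exceeds r for the hypothesis, and z and s for `kind_of_common`.
  refine ⟨Nat.pair z (r + z + s + 1), mem_U.2 (Or.inl rfl), ?_⟩
  by_contra hcon
  push Not at hcon
  obtain ⟨⟨w, hw, hwx⟩, ⟨w', hw', hwy⟩⟩ := hcon
  obtain ⟨h₁, h₂, h₃, h₄, h₅, h₆, h₇⟩ := kind_of_common hxy hx hy hzx hzy
    (show z < r + z + s + 1 by omega) (show s < r + z + s + 1 by omega) hw hwx hw' hwy
  exact hr h₁ _ (by omega) w w' h₂ h₃ h₄ h₅ h₆ h₇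

/-- All points near a middle point share its index d, and d determines m. -/
theorem pair_of_common {x y z s l w w' : ℕ} (hz : z.unpair.1 = 2) (h₁ : Near R z l w)
    (h₂ : Near R x s w) (hx : x.unpair.1 ≤ 1) (h₃ : Near R z l w') (h₄ : Near R y s w')
    (hy : y.unpair.1 ≤ 1) : x.unpair.2 = y.unpair.2 := by
  obtain ⟨a, -⟩ | ⟨-, a, -⟩ := h₁
  · omega
  obtain ⟨-, b, -⟩ | ⟨b, -⟩ := h₂
  swap
  · omega
  obtain ⟨c, -⟩ | ⟨-, c, -⟩ := h₃
  · omega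
  obtain ⟨-, d, -⟩ | ⟨d, -⟩ := h₄
  swap
  · omega
  rw [← b, ← d, a, c]

theorem separated_of_unpair_ne {x y : ℕ} (hxy : x ≠ y)
    (h : ¬ (x.unpair.1 ≤ 1 ∧ y.unpair.1 ≤ 1 ∧ x.unpair.2 = y.unpair.2)) :
    (nearSpace R).SeparatedByClosedNhds x y :=
  separated_of (s := x + y + 1) hxy (by omega) (by omega) fun _ hz =>
    ⟨0, fun _ _ _ _ h₁ h₂ hx h₃ h₄ hy => h ⟨hx, hy, pair_of_common hz h₁ h₂ hx h₃ h₄ hy⟩⟩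

theorem pair_zero_ne_pair_one (m : ℕ) : Nat.pair 0 m ≠ Nat.pair 1 m := by
  simp [Nat.pair_eq_pair]

theorem separated_pair_iff {m : ℕ} :
    (nearSpace R).SeparatedByClosedNhds (Nat.pair 0 m) (Nat.pair 1 m) ↔
      ∃ s, ∀ a ≥ s, ∀ b, ∃ r, ∀ r' ≥ r, ∀ e,
        ¬ R (Nat.pair m (Nat.pair a b)) (Nat.pair r' e) := by
  constructor
  · intro h
    obtain ⟨i, j, hi, hj, h⟩ := (nearSpace R).separatedByClosedNhds_iff.1 h
    -- A non-isolated point lies only in basic sets centred at it.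
    have key : ∀ {i x : ℕ}, x.unpair.1 ≤ 2 → x ∈ (nearSpace R).U i → i.unpair.1 = x := by
      intro i x hx h
      refine (h.resolve_right fun h => ?_).symm
      have := h.le_right
      omega
    have hi := key (by simp) hi
    have hj := key (by simp) hj
    refine ⟨max i.unpair.2 j.unpair.2, fun a ha b => ?_⟩
    by_contra hcon
    push Not at hcon
    obtain ⟨l, hl, h⟩ := h (Nat.pair 2 (Nat.pair m (Nat.pair a b)))
    have hl := key (by simp) hl
    obtain ⟨r, hr, e, hR⟩ := hcon l.unpair.2
    have ha₁ : i.unpair.2 ≤ a := le_trans (le_max_left _ _) ha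
    have ha₂ : j.unpair.2 ≤ a := le_trans (le_max_right _ _) ha
    obtain h | h := h
    · refine h (Nat.pair 3 (Nat.pair (Nat.pair m (Nat.pair a b)) (Nat.pair r e)))
        (Or.inr (Or.inr ?_)) (Or.inr (Or.inl ?_))
      · simp [hl]; exact hr
      · simp [hi]; exact ⟨ha₁, hR⟩
    · refine h (Nat.pair 4 (Nat.pair (Nat.pair m (Nat.pair a b)) (Nat.pair r e)))
        (Or.inr (Or.inr ?_)) (Or.inr (Or.inl ?_))
      · simp [hl]; exact hr
      · simp [hj]; exact ⟨ha₂, hR⟩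
  · rintro ⟨s, h⟩
    refine separated_of (s := s + Nat.pair 0 m + Nat.pair 1 m + 1) (pair_zero_ne_pair_one m)
      (by omega) (by omega) fun z hz => ?_
    by_cases ha : s ≤ z.unpair.2.unpair.2.unpair.1
    · obtain ⟨r, hr⟩ := h _ ha z.unpair.2.unpair.2.unpair.2
      refine ⟨r, fun l hl w w' h₁ h₂ _ _ _ _ => ?_⟩
      obtain ⟨a, -⟩ | ⟨-, a, a'⟩ := h₁
      · omega
      obtain ⟨-, b, -, b'⟩ | ⟨b, -⟩ := h₂
      · refine hr w.unpair.2.unpair.2.unpair.1 (hl.trans a') w.unpair.2.unpair.2.unpair.2 ?_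
        replace b : w.unpair.2.unpair.1.unpair.1 = m := by simpa using b
        rwa [← a, ← b, Nat.pair_unpair, Nat.pair_unpair, Nat.pair_unpair]
      · simp at b
    -- When a < s, no point near this middle point is near p at the chosen radius.
    · refine ⟨0, fun l hl w w' h₁ h₂ _ _ _ _ => ?_⟩
      obtain ⟨a, -⟩ | ⟨-, a, -⟩ := h₁
      · omega
      obtain ⟨-, -, b, -⟩ | ⟨b, -⟩ := h₂
      · rw [a] at b
        omega
      · simp at b

theorem t25Space_iff : T25Space (nearSpace R).Point ↔
    ∀ m : ℕ, (nearSpace R).SeparatedByClosedNhds (Nat.pair 0 m) (Nat.pair 1 m) := by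
  rw [(nearSpace R).t25Space_iff]
  refine ⟨fun h m => h _ _ (pair_zero_ne_pair_one m), fun h x y hxy => ?_⟩
  change ℕ at x y
  by_cases hk : x.unpair.1 ≤ 1 ∧ y.unpair.1 ≤ 1 ∧ x.unpair.2 = y.unpair.2
  · obtain ⟨hx, hy, hm⟩ := hk
    have hne : x.unpair.1 ≠ y.unpair.1 := fun h => hxy (ext_unpair h hm)
    obtain ⟨h₀, h₁⟩ | ⟨h₀, h₁⟩ : (x.unpair.1 = 0 ∧ y.unpair.1 = 1) ∨
        (y.unpair.1 = 0 ∧ x.unpair.1 = 1) := by omega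
    · have ex : Nat.pair 0 x.unpair.2 = x := ext_unpair (by simp [h₀]) (by simp)
      have ey : Nat.pair 1 x.unpair.2 = y := ext_unpair (by simp [h₁]) (by simp [hm])
      have := h x.unpair.2
      rwa [ex, ey] at this
    · have ex : Nat.pair 1 y.unpair.2 = x := ext_unpair (by simp [h₁]) (by simp [hm])
      have ey : Nat.pair 0 y.unpair.2 = y := ext_unpair (by simp [h₀]) (by simp)
      have := h y.unpair.2
      rw [ex, ey] at this
      exact this.symm
  · exact separated_of_unpair_ne hxy hk

end nearSpace

/-! ### Computability of the spaces -/

theorem Primrec.unpair_fst {α : Type*} [Primcodable α] {f : α → ℕ} (hf : Primrec f) :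
    Primrec fun a => (f a).unpair.1 :=
  Primrec.fst.comp (Primrec.unpair.comp hf)

theorem Primrec.unpair_snd {α : Type*} [Primcodable α] {f : α → ℕ} (hf : Primrec f) :
    Primrec fun a => (f a).unpair.2 :=
  Primrec.snd.comp (Primrec.unpair.comp hf)

theorem primrecPred_forall_lt {α : Type*} [Primcodable α] {Q : ℕ → α → Prop} (hQ : PrimrecRel Q)
    {f : α → ℕ} (hf : Primrec f) : PrimrecPred fun a => ∀ y < f a, Q y a :=
  PrimrecPred.of_eq (PrimrecRel.comp (PrimrecRel.forall_mem_list hQ)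
    (Primrec.list_range.comp hf) Primrec.id) fun a => by simp

theorem primrec_codedEntry {α : Type*} [Primcodable α] {f g : α → ℕ} (hf : Primrec f)
    (hg : Primrec g) : Primrec fun a => codedEntry (f a) (g a) :=
  (Primrec.list_getD 0).comp ((Primrec.ofNat (List ℕ)).comp hf) hg

theorem primrecPred_stage (c : Code) :
    PrimrecPred fun v : ℕ × ℕ × ℕ => Stage c v.1 v.2.1 v.2.2 := by
  have hd : Primrec fun v : ℕ × ℕ × ℕ => v.2.1 := Primrec.fst.comp Primrec.snd
  have ht : Primrec fun v : ℕ × ℕ × ℕ => v.2.2 := Primrec.snd.comp Primrec.snd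
  have hz : Primrec fun u : ℕ × ℕ × ℕ × ℕ × ℕ => u.1 := Primrec.fst
  have hy : Primrec fun u : ℕ × ℕ × ℕ × ℕ × ℕ => u.2.1 := Primrec.fst.comp Primrec.snd
  have hv : Primrec fun u : ℕ × ℕ × ℕ × ℕ × ℕ => u.2.2 := Primrec.snd.comp Primrec.snd
  have hvd := hd.comp hv
  have harg : Primrec fun u : ℕ × ℕ × ℕ × ℕ × ℕ => Nat.pair (Nat.pair (Nat.pair
      (Nat.pair u.2.2.1 u.2.2.2.1.unpair.1) u.2.1)
      (codedEntry u.2.2.2.1.unpair.2.unpair.2 u.2.1)) u.1 :=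
    Primrec₂.natPair.comp (Primrec₂.natPair.comp (Primrec₂.natPair.comp (Primrec₂.natPair.comp
      (Primrec.fst.comp hv) hvd.unpair_fst) hy)
      (primrec_codedEntry hvd.unpair_snd.unpair_snd hy)) hz
  have hev : Primrec fun u : ℕ × ℕ × ℕ × ℕ × ℕ => (Code.evaln u.2.2.2.2.unpair.2 c
      (Nat.pair (Nat.pair (Nat.pair (Nat.pair u.2.2.1 u.2.2.2.1.unpair.1) u.2.1)
        (codedEntry u.2.2.2.1.unpair.2.unpair.2 u.2.1)) u.1)).isSome :=
    Primrec.option_isSome.comp (Code.primrec_evaln.comp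
      (((ht.comp hv).unpair_snd.pair (Primrec.const c)).pair harg))
  have hrel : PrimrecRel fun (z : ℕ) (u : ℕ × ℕ × ℕ × ℕ) => (Code.evaln u.2.2.2.unpair.2 c
      (Nat.pair (Nat.pair (Nat.pair (Nat.pair u.2.1 u.2.2.1.unpair.1) u.1)
        (codedEntry u.2.2.1.unpair.2.unpair.2 u.1)) z)).isSome = true :=
    PrimrecRel.comp Primrec.eq hev (Primrec.const true)
  have hall : PrimrecRel fun (y : ℕ) (v : ℕ × ℕ × ℕ) => ∀ z < v.2.2.unpair.1 + 1,
      (Code.evaln v.2.2.unpair.2 c (Nat.pair (Nat.pair (Nat.pair (Nat.pair v.1 v.2.1.unpair.1) y)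
        (codedEntry v.2.1.unpair.2.unpair.2 y)) z)).isSome = true :=
    primrecPred_forall_lt hrel (Primrec.succ.comp (ht.comp
      (Primrec.snd : Primrec (Prod.snd : ℕ × ℕ × ℕ × ℕ → _))).unpair_fst)
  exact primrecPred_forall_lt hall (Primrec.succ.comp hd.unpair_snd.unpair_fst)

theorem primrecPred_near (c : Code) :
    PrimrecPred fun v : ℕ × ℕ × ℕ × ℕ => Near (Stage c v.1) v.2.1 v.2.2.1 v.2.2.2 := by
  have hx : Primrec fun v : ℕ × ℕ × ℕ × ℕ => v.2.1 := Primrec.fst.comp Primrec.snd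
  have hs : Primrec fun v : ℕ × ℕ × ℕ × ℕ => v.2.2.1 :=
    Primrec.fst.comp (Primrec.snd.comp Primrec.snd)
  have hy : Primrec fun v : ℕ × ℕ × ℕ × ℕ => v.2.2.2 :=
    Primrec.snd.comp (Primrec.snd.comp Primrec.snd)
  have hd := hy.unpair_snd.unpair_fst
  have ht := hy.unpair_snd.unpair_snd
  have hR := (primrecPred_stage c).comp (Primrec.fst.pair (hd.pair ht))
  refine PrimrecPred.or (((PrimrecRel.comp Primrec.nat_le hx.unpair_fst (Primrec.const 1)).and
    (PrimrecRel.comp Primrec.eq hy.unpair_fst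
      (Primrec.nat_add.comp hx.unpair_fst (Primrec.const 3)))).and
    ((PrimrecRel.comp Primrec.eq hd.unpair_fst hx.unpair_snd).and
      ((PrimrecRel.comp Primrec.nat_le hs hd.unpair_snd.unpair_fst).and hR))) ?_
  exact ((PrimrecRel.comp Primrec.eq hx.unpair_fst (Primrec.const 2)).and
    (PrimrecRel.comp Primrec.nat_le (Primrec.const 3) hy.unpair_fst)).and
    ((PrimrecRel.comp Primrec.eq hd hx.unpair_snd).and
      (PrimrecRel.comp Primrec.nat_le hs ht.unpair_fst))

theorem exists_code_eval_eq {f : ℕ → ℕ} (hf : Computable f) :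
    ∃ c : Code, ∀ n, Code.eval c n = Part.some (f n) := by
  obtain ⟨c, hc⟩ := Code.exists_code.1 (Partrec.nat_iff.1 hf.partrec)
  exact ⟨c, fun n => congrFun hc n⟩

theorem exists_code_decides {p : ℕ → Prop} (hp : PrimrecPred p) : ∃ c : Code, ∀ n,
    (p n → 1 ∈ Code.eval c n) ∧ (¬ p n → 0 ∈ Code.eval c n) := by
  have _ : DecidablePred p := hp.choose
  obtain ⟨c, hc⟩ := exists_code_eval_eq
    (Primrec.ite hp (Primrec.const 1) (Primrec.const 0)).to_comp
  refine ⟨c, fun n => ⟨fun h => ?_, fun h => ?_⟩⟩ <;> simp [hc, h]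

theorem primrecPred_mem_U (c : Code) : PrimrecPred fun v : ℕ × ℕ × ℕ =>
    v.2.2 = v.2.1.unpair.1 ∨ Near (Stage c v.1) v.2.1.unpair.1 v.2.1.unpair.2 v.2.2 := by
  have hi : Primrec fun v : ℕ × ℕ × ℕ => v.2.1 := Primrec.fst.comp Primrec.snd
  have hy : Primrec fun v : ℕ × ℕ × ℕ => v.2.2 := Primrec.snd.comp Primrec.snd
  have hv : Primrec fun v : ℕ × ℕ × ℕ => (v.1, v.2.1.unpair.1, v.2.1.unpair.2, v.2.2) :=
    Primrec.fst.pair (hi.unpair_fst.pair (hi.unpair_snd.pair hy))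
  have h₁ : PrimrecPred fun v : ℕ × ℕ × ℕ => v.2.2 = v.2.1.unpair.1 :=
    PrimrecRel.comp Primrec.eq hy hi.unpair_fst
  have h₂ := (primrecPred_near c).comp hv
  exact h₁.or h₂

theorem exists_code_mem_U (c : Code) : ∃ cU : Code, ∀ n i x,
    (x ∈ (nearSpace (Stage c n)).U i → 1 ∈ Code.eval cU (Nat.pair n (Nat.pair i x))) ∧
    (x ∉ (nearSpace (Stage c n)).U i → 0 ∈ Code.eval cU (Nat.pair n (Nat.pair i x))) := by
  have hv : Primrec fun v : ℕ => (v.unpair.1, v.unpair.2.unpair.1, v.unpair.2.unpair.2) :=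
    Primrec.id.unpair_fst.pair (Primrec.id.unpair_snd.unpair_fst.pair
      Primrec.id.unpair_snd.unpair_snd)
  obtain ⟨cU, hcU⟩ := exists_code_decides ((primrecPred_mem_U c).comp hv)
  refine ⟨cU, fun n i x => ?_⟩
  have h := hcU (Nat.pair n (Nat.pair i x))
  simp only [Nat.unpair_pair] at h
  exact h

/-- The function `k` ignores R, so one code serves every space. -/
theorem exists_code_k : ∃ ck : Code, ∀ R i j x,
    (nearSpace R).k i j x ∈ Code.eval ck (Nat.pair i (Nat.pair j x)) := by
  have hi : Primrec fun v : ℕ => v.unpair.1 := Primrec.id.unpair_fst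
  have hj : Primrec fun v : ℕ => v.unpair.2.unpair.1 := Primrec.id.unpair_snd.unpair_fst
  have hy : Primrec fun v : ℕ => v.unpair.2.unpair.2 := Primrec.id.unpair_snd.unpair_snd
  obtain ⟨ck, hck⟩ := exists_code_eval_eq (Primrec₂.natPair.comp hy
    (Primrec.nat_max.comp hi.unpair_snd hj.unpair_snd)).to_comp
  refine ⟨ck, fun R i j x => ?_⟩
  simp [hck, nearSpace]

theorem exists_computable_isIndex (c : Code) :
    ∃ f : ℕ → ℕ, Computable f ∧ ∀ n, IsIndex (f n) (nearSpace (Stage c n)) := by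
  obtain ⟨cU, hcU⟩ := exists_code_mem_U c
  obtain ⟨ck, hck⟩ := exists_code_k
  -- Currying (the s-m-n theorem) makes the index computable from n.
  refine ⟨fun n => Nat.pair (encode (Code.curry cU n)) (encode ck), ?_, fun n => ?_⟩
  · have hc : Primrec fun n => Code.curry cU n :=
      Code.primrec₂_curry.comp (Primrec.const cU) Primrec.id
    exact (Primrec₂.natPair.comp (Primrec.encode.comp hc) (Primrec.const _)).to_comp
  · have h₁ : Phi (Nat.pair (encode (Code.curry cU n)) (encode ck)).unpair.1 =
        Code.eval (Code.curry cU n) := by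
      rw [Phi, Nat.unpair_pair, Denumerable.ofNat_encode]
    have h₂ : Phi (Nat.pair (encode (Code.curry cU n)) (encode ck)).unpair.2 = Code.eval ck := by
      rw [Phi, Nat.unpair_pair, Denumerable.ofNat_encode]
    refine ⟨fun i x h => ?_, fun i x h => ?_, fun i j x => ?_⟩
    · rw [h₁, Code.eval_curry]
      exact (hcU n i x).1 h
    · rw [h₁, Code.eval_curry]
      exact (hcU n i x).2 h
    · rw [h₂]
      exact hck _ i j x

/-! ### The theorem -/

theorem exists_computable_isIndex_separated {A : Set ℕ} (hA : IsSigma 4 A) :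
    ∃ f : ℕ → ℕ, Computable f ∧ ∃ p q : ℕ → ℕ, (∀ m, p m ≠ q m) ∧
      ∀ n, ∃ X : CSCSpace, IsIndex (f n) X ∧ T2Space X.Point ∧
        (∀ m, X.SeparatedByClosedNhds (p m) (q m) ↔ Nat.pair n m ∈ A) ∧
        (T25Space X.Point ↔ ∀ m, Nat.pair n m ∈ A) := by
  obtain ⟨c, hc⟩ := hA.exists_stage
  obtain ⟨f, hf, hX⟩ := exists_computable_isIndex c
  have hsep : ∀ n m : ℕ, (nearSpace (Stage c n)).SeparatedByClosedNhds (Nat.pair 0 m)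
      (Nat.pair 1 m) ↔ Nat.pair n m ∈ A := fun n m =>
    nearSpace.separated_pair_iff.trans (hc n m).symm
  exact ⟨f, hf, Nat.pair 0, Nat.pair 1, nearSpace.pair_zero_ne_pair_one, fun n =>
    ⟨_, hX n, nearSpace.t2Space _, hsep n, nearSpace.t25Space_iff.trans (forall_congr' (hsep n))⟩⟩

theorem hardWithin_T25CSC : HardWithin (PiClass 5) T25CSC T2CSC := by
  rintro B ⟨C, hC, hB⟩
  obtain ⟨f, hf, p, q, -, hX⟩ := exists_computable_isIndex_separated (A := Cᶜ) hC
  refine ⟨f, hf, fun e => ?_⟩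
  obtain ⟨X, hi, h2, -, h25⟩ := hX e
  refine ⟨⟨X, hi, h2⟩, ?_⟩
  -- A Π⁰₅ set is a universal quantifier over a Σ⁰₄ relation, which the spaces realise pair by pair.
  have hBe : e ∈ B ↔ ∀ m, Nat.pair e m ∈ Cᶜ := by
    rw [← not_iff_not, ← Set.mem_compl_iff, hB, not_forall]
    exact exists_congr fun m => not_not.symm
  rw [hBe, ← h25]
  refine ⟨fun h => ⟨X, hi, h⟩, ?_⟩
  rintro ⟨Y, hY, h⟩
  rwa [hi.unique hY]

theorem T25CSC_subset_T2CSC : T25CSC ⊆ T2CSC := by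
  rintro e ⟨X, hX, h⟩
  exact ⟨X, hX, inferInstance⟩

theorem mainTheorem2 :
    T25CSC ∈ PiClass 5 ∧
    CompleteWithin (PiClass 5) T25CSC T2CSC ∧
    ∀ A : Set ℕ, IsSigma 4 A →
      ∃ f : ℕ → ℕ, Computable f ∧ ∃ p q : ℕ → ℕ, (∀ m, p m ≠ q m) ∧
        ∀ n, ∃ X : CSCSpace, IsIndex (f n) X ∧ T2Space X.Point ∧
          (∀ m, X.SeparatedByClosedNhds (p m) (q m) ↔ Nat.pair n m ∈ A) ∧
          (T25Space X.Point ↔ ∀ m, Nat.pair n m ∈ A) :=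
  ⟨T25CSC_mem_piClass,
    ⟨⟨T25CSC, T25CSC_mem_piClass, (Set.inter_eq_left.2 T25CSC_subset_T2CSC).symm⟩,
      hardWithin_T25CSC⟩,
    fun _ hA => exists_computable_isIndex_separated hA⟩
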